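/- All functions, hypersurfaces and vector fields are $C^\infty$; functions are complex-valued and vector fields have complex coefficients. Let $S\subset\mathbb C^2$ be a strongly pseudoconvex real hypersurface which is circular (that is, $e^{i\theta}z\in S$ for all $z\in S$, $\theta\in\mathbb R$) and such that no complex tangent line of $S$ passes through the origin. Let $w=(w_1,w_2)\colon S\to\mathbb C^2\setminus\{0\}$ be the unique map such that $z_1w_1+z_2w_2=1$ on $S$ and the vector field $$Y=w_2\frac{\partial}{\partial z_1}-w_1\frac{\partial}{\partial z_2}$$ is tangent to $S$, and let $X=\alpha\bar Y$, where $\alpha$ is the unique scalar function on $S$ for which $Xw_1=z_2$ and $Xw_2=-z_1$. A function is conjugate-CR if its complex conjugate is CR. Let $\tilde X,\tilde Y$ be nowhere-vanishing tangential vector fields on $S$ such that 1. a function $u$ on a relatively open subset of $S$ is CR if and only if $\tilde Xu=0$; 2. a function $u$ on a relatively open subset of $S$ is CR if and only if $\tilde Y\bar u=0$; 3. $\tilde X\tilde X\tilde Y u=0$ for every CR function $u$ on $S$ and every conjugate-CR function $u$ on $S$. Then there are CR functions $f_1,f_2,f_3$ on $S$ such that $f_1w_1+f_2w_2$ and $f_3$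 vanish nowhere on $S$ and $$\tilde X=f_3\,(f_1w_1+f_2w_2)^2\,X,\qquad \tilde Y=\frac{1}{f_1w_1+f_2w_2}\,Y .$$ -/

import Mathlib

open scoped ContDiff

noncomputable section

/-- A smooth real hypersurface is given locally as the regular zero set of a smooth real function:
`ρ` is a local defining function of `S` near `p`. -/
def IsLocalDefiningFunction (S : Set (ℂ × ℂ)) (p : ℂ × ℂ) (ρ : ℂ × ℂ → ℝ) : Prop :=
  ∃ U : Set (ℂ × ℂ), IsOpen U ∧ p ∈ U ∧ ContDiffOn ℝ ∞ ρ U ∧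
    (∀ z ∈ U, fderiv ℝ ρ z ≠ 0) ∧ S ∩ U = {z ∈ U | ρ z = 0}

/-- Smooth (embedded, not necessarily closed) real hypersurface in `ℂ²`. -/
def IsRealHypersurface (S : Set (ℂ × ℂ)) : Prop :=
  ∀ p ∈ S, ∃ ρ, IsLocalDefiningFunction S p ρ

/-- The maximal complex subspace `H_p S = T_p S ∩ i T_p S` of the real tangent space
`T_p S = ker dρ_p`. -/
def complexTangentSpace (S : Set (ℂ × ℂ)) (p : ℂ × ℂ) : Set (ℂ × ℂ) :=
  {a | ∀ ρ, IsLocalDefiningFunction S p ρ →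
    fderiv ℝ ρ p a = 0 ∧ fderiv ℝ ρ p (Complex.I • a) = 0}

/-- The Levi form `∑ ∂²ρ/∂z_j∂z̄_k a_j ā_k`, written through the real Hessian of `ρ`. -/
def leviForm (ρ : ℂ × ℂ → ℝ) (p a : ℂ × ℂ) : ℝ :=
  (fderiv ℝ (fderiv ℝ ρ) p a a
    + fderiv ℝ (fderiv ℝ ρ) p (Complex.I • a) (Complex.I • a)) / 4

/-- Strongly pseudoconvex real hypersurface: near each point some defining function
(that is, some choice of side) has positive definite Levi form on `H_p S`. -/
def IsStronglyPseudoconvex (S : Set (ℂ × ℂ)) : Prop :=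
  IsRealHypersurface S ∧
    ∀ p ∈ S, ∃ ρ, IsLocalDefiningFunction S p ρ ∧
      ∀ a ∈ complexTangentSpace S p, a ≠ 0 → 0 < leviForm ρ p a

/-- Invariance under the rotations `z ↦ e^{iθ} z`. -/
def IsCircular (S : Set (ℂ × ℂ)) : Prop :=
  ∀ θ : ℝ, ∀ z ∈ S, Complex.exp (Complex.I * θ) • z ∈ S

/-- No complex tangent line `p + H_p S` of `S` passes through the origin. -/
def NoTangentLineThroughOrigin (S : Set (ℂ × ℂ)) : Prop :=
  ∀ p ∈ S, ¬ ∃ a ∈ complexTangentSpace S p, p + a = 0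

/-- Complexified tangent vectors of `ℂ²`: `((a₁, a₂), (b₁, b₂))` stands for
`a₁ ∂/∂z₁ + a₂ ∂/∂z₂ + b₁ ∂/∂z̄₁ + b₂ ∂/∂z̄₂`. -/
abbrev ComplexVector : Type := (ℂ × ℂ) × (ℂ × ℂ)

/-- The value on a complexified tangent vector of a real-linear functional `L` (a differential),
with `∂/∂z_j ↦ (L e_j - i L (i e_j)) / 2` and `∂/∂z̄_j ↦ (L e_j + i L (i e_j)) / 2`. -/
def evalComplex (L : ℂ × ℂ →L[ℝ] ℂ) (v : ComplexVector) : ℂ :=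
  v.1.1 * ((L (1, 0) - Complex.I * L (Complex.I, 0)) / 2)
    + v.1.2 * ((L (0, 1) - Complex.I * L (0, Complex.I)) / 2)
    + v.2.1 * ((L (1, 0) + Complex.I * L (Complex.I, 0)) / 2)
    + v.2.2 * ((L (0, 1) + Complex.I * L (0, Complex.I)) / 2)

/-- The complexified vector `v` lies in `T_p S ⊗ ℂ`. -/
def IsTangentVector (S : Set (ℂ × ℂ)) (p : ℂ × ℂ) (v : ComplexVector) : Prop :=
  ∀ ρ, IsLocalDefiningFunction S p ρ →
    evalComplex (Complex.ofRealCLM.comp (fderiv ℝ ρ p)) v = 0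

/-- Smoothness of a map on `S` (only its values on `S` matter): near each point of `S` it has a
smooth extension to an open subset of `ℂ²`. -/
def IsSmoothOn {E : Type*} [NormedAddCommGroup E] [NormedSpace ℝ E]
    (S : Set (ℂ × ℂ)) (f : ℂ × ℂ → E) : Prop :=
  ∀ p ∈ S, ∃ U : Set (ℂ × ℂ), IsOpen U ∧ p ∈ U ∧
    ∃ g : ℂ × ℂ → E, ContDiffOn ℝ ∞ g U ∧ Set.EqOn g f (S ∩ U)

/-- Smooth (complex) tangential vector field on `S`. -/
def IsTangentialField (S : Set (ℂ × ℂ)) (X : ℂ × ℂ → ComplexVector) : Prop :=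
  IsSmoothOn S X ∧ ∀ p ∈ S, IsTangentVector S p (X p)

/-- The function `X u` on `S`, for a tangential field `X` and a smooth function `u` on `S`.
All derivatives of `u` within `S` at `p` agree on `T_p S`, so for such `X` this is the derivative of
any smooth extension of `u`, and it depends only on the values of `u` on `S`. -/
def applyField (S : Set (ℂ × ℂ)) (X : ℂ × ℂ → ComplexVector) (u : ℂ × ℂ → ℂ) : ℂ × ℂ → ℂ :=
  fun p => evalComplex (fderivWithin ℝ u S p) (X p)

/-- Smooth CR functions on `S`: annihilated by all tangential vectors of type `(0,1)`. -/
def IsCR (S : Set (ℂ × ℂ)) (u : ℂ × ℂ → ℂ) : Prop :=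
  IsSmoothOn S u ∧
    ∀ p ∈ S, ∀ b : ℂ × ℂ, IsTangentVector S p (0, b) →
      evalComplex (fderivWithin ℝ u S p) (0, b) = 0

/-- Conjugate-CR functions on `S`. -/
def IsConjCR (S : Set (ℂ × ℂ)) (u : ℂ × ℂ → ℂ) : Prop :=
  IsCR S (fun z => starRingEnd ℂ (u z))

/-- The map `z ↦ w(z) = (w₁, w₂)`: the unique `w` with `z₁ w₁ + z₂ w₂ = 1` and
`w₂ ∂/∂z₁ - w₁ ∂/∂z₂` tangent to `S` at `z`. It exists at every point of a real hypersurface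
without complex tangent lines through the origin. -/
def dualMap (S : Set (ℂ × ℂ)) (z : ℂ × ℂ) : ℂ × ℂ :=
  Classical.epsilon fun w : ℂ × ℂ =>
    z.1 * w.1 + z.2 * w.2 = 1 ∧ IsTangentVector S z ((w.2, -w.1), 0)

/-- `Y = w₂ ∂/∂z₁ - w₁ ∂/∂z₂`. -/
def fieldY (S : Set (ℂ × ℂ)) : ℂ × ℂ → ComplexVector :=
  fun z => (((dualMap S z).2, -(dualMap S z).1), 0)

/-- The complex conjugate field `Ȳ = w̄₂ ∂/∂z̄₁ - w̄₁ ∂/∂z̄₂`. -/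
def fieldYbar (S : Set (ℂ × ℂ)) : ℂ × ℂ → ComplexVector :=
  fun z => (0, (starRingEnd ℂ (dualMap S z).2, -starRingEnd ℂ (dualMap S z).1))

/-- The scalar function `α` on `S` for which `X = α Ȳ` satisfies `X w₁ = z₂` and `X w₂ = -z₁`.
It exists and is unique when `S` is strongly pseudoconvex and no complex tangent line of `S` passes
through the origin. -/
def scalarAlpha (S : Set (ℂ × ℂ)) (z : ℂ × ℂ) : ℂ :=
  Classical.epsilon fun α : ℂ =>
    α * applyField S (fieldYbar S) (fun ζ => (dualMap S ζ).1) z = z.2 ∧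
      α * applyField S (fieldYbar S) (fun ζ => (dualMap S ζ).2) z = -z.1

/-- `X = α Ȳ`. -/
def fieldX (S : Set (ℂ × ℂ)) : ℂ × ℂ → ComplexVector :=
  fun z => scalarAlpha S z • fieldYbar S z

end

/-!
Write `w` for the dual map. Differentiating `z₁ w₁ + z₂ w₂ = 1` along `Ȳ` gives `Ȳ w₁ = β z₂`,
`Ȳ w₂ = -β z₁` for a function `β`. Since `∂ρ = (z · ∂ρ) w` for every defining function `ρ`, the
Levi form in the direction `(w₂, -w₁)` equals `(z · ∂ρ) β`, so strong pseudoconvexity makes `β`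
nonvanishing (`leviCoefficient_ne_zero`) and `X = β⁻¹ Ȳ` (`scalarAlpha_eq_inv`).

The coordinate functions are CR, so the given fields satisfy `X' z_j = 0` and `Y' z̄_j = 0`. Hence
`X' = F X` and `Y' = G Y` with smooth nonvanishing `F`, `G` (`eq_smul_fieldY`,
`eq_smul_fieldYbar`), and in particular `X' w₁ = F z₂`, `X' w₂ = -F z₁`. The annihilation property,
used for `z₁` and `z₂` only, says that `k_j = X' Y' z_j` is CR. Expanding,
`k₁ = (X' G) w₂ - F G z₁` and `k₂ = -(X' G) w₁ - F G z₂`, so `k₁ w₁ + k₂ w₂ = -F G`. Applying `X'`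
to this identity yields `X' (F G) = -F X' G`, and therefore `X' (F G²) = 0`. Thus `f₃ = F G²`,
`f₁ = -k₁ / f₃` and `f₂ = -k₂ / f₃` are CR, and `f₁ w₁ + f₂ w₂ = 1 / G`.

The calculus behind this takes place on a set without unique differentiability: derivatives within
`S` are determined only on tangent vectors (`evalComplex_fderivWithin`), because by the implicit
function theorem each vector of `ker dρ` is the velocity of a curve in `S`. This makes tangential
fields derivations on functions smooth on `S`.
-/

open Filter Topology ComplexConjugate

/-! ### Calculus on a real hypersurface -/

lemma evalComplex_sub (L M : ℂ × ℂ →L[ℝ] ℂ) (v : ComplexVector) :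
    evalComplex (L - M) v = evalComplex L v - evalComplex M v := by
  simp only [evalComplex, sub_apply]; ring

lemma evalComplex_smul_right (L : ℂ × ℂ →L[ℝ] ℂ) (c : ℂ) (v : ComplexVector) :
    evalComplex L (c • v) = c * evalComplex L v := by
  simp only [evalComplex, Prod.smul_fst, Prod.smul_snd, smul_eq_mul]; ring

lemma apply_eq_sum (L : ℂ × ℂ →L[ℝ] ℂ) (a : ℂ × ℂ) :
    L a = a.1.re * L (1, 0) + a.1.im * L (Complex.I, 0) + a.2.re * L (0, 1)
      + a.2.im * L (0, Complex.I) := by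
  have h : a = a.1.re • ((1 : ℂ), (0 : ℂ)) + a.1.im • (Complex.I, (0 : ℂ))
      + a.2.re • ((0 : ℂ), (1 : ℂ)) + a.2.im • ((0 : ℂ), Complex.I) := by
    ext <;> simp
  conv_lhs => rw [h]
  simp only [map_add, map_smul, Complex.real_smul]

/-- On `(1,0)` vectors, `evalComplex L` is the complex-linear part of `L`. -/
lemma evalComplex_holomorphic (L : ℂ × ℂ →L[ℝ] ℂ) (a : ℂ × ℂ) :
    evalComplex L (a, 0) = (L a - Complex.I * L (Complex.I • a)) / 2 := by
  rw [apply_eq_sum L a, apply_eq_sum L (Complex.I • a)]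
  have h1 := Complex.re_add_im a.1
  have h2 := Complex.re_add_im a.2
  simp [evalComplex]
  linear_combination
    -(L (1, 0) - Complex.I * L (Complex.I, 0)) / 2 * h1
    -(L (0, 1) - Complex.I * L (0, Complex.I)) / 2 * h2
    - (a.1.im * L (Complex.I, 0) + a.2.im * L (0, Complex.I)) / 2 * Complex.I_sq

/-- On `(0,1)` vectors, `evalComplex L` is the antilinear part of `L`. -/
lemma evalComplex_antiholomorphic (L : ℂ × ℂ →L[ℝ] ℂ) (a : ℂ × ℂ) :
    evalComplex L (0, (conj a.1, conj a.2)) = (L a + Complex.I * L (Complex.I • a)) / 2 := by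
  rw [apply_eq_sum L a, apply_eq_sum L (Complex.I • a)]
  have h1 : conj a.1 = a.1.re - a.1.im * Complex.I := by
    apply Complex.ext <;> simp
  have h2 : conj a.2 = a.2.re - a.2.im * Complex.I := by
    apply Complex.ext <;> simp
  simp [evalComplex, h1, h2]
  linear_combination
    - (a.1.im * L (Complex.I, 0) + a.2.im * L (0, Complex.I)) / 2 * Complex.I_sq

lemma evalComplex_conj (L : ℂ × ℂ →L[ℝ] ℝ) (v : ComplexVector) :
    conj (evalComplex (Complex.ofRealCLM.comp L) v) = evalComplex (Complex.ofRealCLM.comp L)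
      ((conj v.2.1, conj v.2.2), (conj v.1.1, conj v.1.2)) := by
  simp only [evalComplex, ContinuousLinearMap.comp_apply, Complex.ofRealCLM_apply, map_add, map_sub,
    map_mul, map_div₀, Complex.conj_ofReal, Complex.conj_I, map_ofNat]
  ring

lemma IsLocalDefiningFunction.contDiffAt {S : Set (ℂ × ℂ)} {p : ℂ × ℂ} {ρ : ℂ × ℂ → ℝ}
    (h : IsLocalDefiningFunction S p ρ) : ContDiffAt ℝ ∞ ρ p := by
  obtain ⟨U, hU, hpU, hρ, -⟩ := h
  exact hρ.contDiffAt (hU.mem_nhds hpU)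

lemma IsLocalDefiningFunction.eventually {S : Set (ℂ × ℂ)} {p : ℂ × ℂ} {ρ : ℂ × ℂ → ℝ}
    (h : IsLocalDefiningFunction S p ρ) : ∀ᶠ z in 𝓝 p, IsLocalDefiningFunction S z ρ := by
  obtain ⟨U, hU, hpU, h⟩ := h
  filter_upwards [hU.mem_nhds hpU] with z hz using ⟨U, hU, hz, h⟩

lemma IsLocalDefiningFunction.fderiv_ne_zero {S : Set (ℂ × ℂ)} {p : ℂ × ℂ} {ρ : ℂ × ℂ → ℝ}
    (h : IsLocalDefiningFunction S p ρ) : fderiv ℝ ρ p ≠ 0 := by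
  obtain ⟨U, hU, hpU, hρ, h0, -⟩ := h
  exact h0 p hpU

lemma IsLocalDefiningFunction.eventually_mem_iff {S : Set (ℂ × ℂ)} {p : ℂ × ℂ} {ρ : ℂ × ℂ → ℝ}
    (h : IsLocalDefiningFunction S p ρ) : ∀ᶠ z in 𝓝 p, z ∈ S ↔ ρ z = 0 := by
  obtain ⟨U, hU, hpU, -, -, h⟩ := h
  filter_upwards [hU.mem_nhds hpU] with z hz
  have := Set.ext_iff.1 h z
  simpa [hz] using this

/-- By the implicit function theorem, every vector in the kernel of `dρ` is the velocity of a curve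
in the hypersurface. -/
lemma IsLocalDefiningFunction.exists_curve {S : Set (ℂ × ℂ)} {p : ℂ × ℂ} {ρ : ℂ × ℂ → ℝ}
    (h : IsLocalDefiningFunction S p ρ) (hp : p ∈ S) {a : ℂ × ℂ} (ha : fderiv ℝ ρ p a = 0) :
    ∃ c : ℝ → ℂ × ℂ, c 0 = p ∧ HasDerivAt c a 0 ∧ ∀ᶠ t in 𝓝 0, c t ∈ S := by
  have hs : HasStrictFDerivAt ρ (fderiv ℝ ρ p) p := h.contDiffAt.hasStrictFDerivAt (by simp)
  have hsurj : (fderiv ℝ ρ p).range = ⊤ := by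
    rw [LinearMap.range_eq_top]
    exact LinearMap.surjective (f := (fderiv ℝ ρ p).toLinearMap) fun h' =>
      h.fderiv_ne_zero (ContinuousLinearMap.coe_injective h')
  have hρp : ρ p = 0 := h.eventually_mem_iff.self_of_nhds.1 hp
  set g := hs.implicitFunction ρ (fderiv ℝ ρ p) hsurj
  let k : (fderiv ℝ ρ p).ker := ⟨a, ha⟩
  have hk : HasDerivAt (fun t : ℝ => t • k) k 0 := by
    simpa using (hasDerivAt_id (0 : ℝ)).smul_const k
  have hg0 : g (ρ p) 0 = p := hs.implicitFunction_apply_image hsurj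
  have hg := (hs.to_implicitFunction hsurj).hasFDerivAt
  have hc : HasDerivAt (fun t : ℝ => g (ρ p) (t • k)) a 0 := by
    rw [show (0 : (fderiv ℝ ρ p).ker) = (0 : ℝ) • k by simp] at hg
    exact hg.comp_hasDerivAt (0 : ℝ) hk
  refine ⟨fun t => g (ρ p) (t • k), by simpa using hg0, hc, ?_⟩
  have hcont : Tendsto (fun t : ℝ => g (ρ p) (t • k)) (𝓝 0) (𝓝 p) := by
    have := hc.continuousAt.tendsto
    simpa [hg0] using this
  have hk0 : Tendsto (fun t : ℝ => (ρ p, t • k)) (𝓝 0) (𝓝 (ρ p, 0)) := by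
    have : Tendsto (fun t : ℝ => t • k) (𝓝 0) (𝓝 0) := by
      simpa using hk.continuousAt.tendsto
    exact tendsto_const_nhds.prodMk_nhds this
  filter_upwards [hcont.eventually h.eventually_mem_iff,
    hk0.eventually (hs.map_implicitFunction_eq hsurj)] with t h1 h2
  exact h1.2 (h2.trans hρp)

/-- `S` is not a set of unique differentiability in `ℂ²`, but two derivatives within `S` agree on
`ker dρ`. -/
lemma IsLocalDefiningFunction.hasFDerivWithinAt_unique {S : Set (ℂ × ℂ)} {p : ℂ × ℂ}
    {ρ : ℂ × ℂ → ℝ} (h : IsLocalDefiningFunction S p ρ) (hp : p ∈ S)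
    {E : Type*} [NormedAddCommGroup E] [NormedSpace ℝ E] {u : ℂ × ℂ → E}
    {L M : ℂ × ℂ →L[ℝ] E} (hL : HasFDerivWithinAt u L S p) (hM : HasFDerivWithinAt u M S p)
    {a : ℂ × ℂ} (ha : fderiv ℝ ρ p a = 0) : L a = M a := by
  obtain ⟨c, rfl, hc, hcS⟩ := h.exists_curve hp ha
  have hc' : HasDerivWithinAt c a (c ⁻¹' S) 0 := hc.hasDerivWithinAt
  have key : ∀ N : ℂ × ℂ →L[ℝ] E, HasFDerivWithinAt u N S (c 0) → HasDerivAt (u ∘ c) (N a) 0 :=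
    fun N hN => (hN.comp_hasDerivWithinAt (0 : ℝ) hc' (Set.mapsTo_preimage c S)).hasDerivAt hcS
  exact (key L hL).unique (key M hM)

/-- A real-linear functional vanishing on `ker dρ` is a multiple of `dρ`, hence vanishes on
complexified tangent vectors. -/
lemma evalComplex_eq_zero {D : ℂ × ℂ →L[ℝ] ℝ} (hD : D ≠ 0) {M : ℂ × ℂ →L[ℝ] ℂ}
    (hM : ∀ a, D a = 0 → M a = 0) {v : ComplexVector}
    (hv : evalComplex (Complex.ofRealCLM.comp D) v = 0) : evalComplex M v = 0 := by
  obtain ⟨e, he⟩ : ∃ e, D e ≠ 0 := by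
    by_contra! h
    exact hD (ContinuousLinearMap.ext h)
  obtain ⟨c, hc⟩ : ∃ c : ℂ, ∀ x, M x = c * D x := ⟨M e / D e, fun x => by
    have h := hM (x - (D x / D e) • e)
      (by rw [map_sub, map_smul, smul_eq_mul, div_mul_cancel₀ _ he, sub_self])
    rw [map_sub, map_smul, sub_eq_zero] at h
    rw [h, Complex.real_smul, Complex.ofReal_div]
    ring⟩
  have : evalComplex M v = c * evalComplex (Complex.ofRealCLM.comp D) v := by
    simp only [evalComplex, hc, ContinuousLinearMap.comp_apply, Complex.ofRealCLM_apply]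
    ring
  rw [this, hv, mul_zero]

/-- Tangency can be tested with a single defining function. -/
lemma IsLocalDefiningFunction.isTangentVector_iff {S : Set (ℂ × ℂ)} {p : ℂ × ℂ} {ρ : ℂ × ℂ → ℝ}
    (h : IsLocalDefiningFunction S p ρ) (hp : p ∈ S) {v : ComplexVector} :
    IsTangentVector S p v ↔ evalComplex (Complex.ofRealCLM.comp (fderiv ℝ ρ p)) v = 0 := by
  refine ⟨fun hv => hv ρ h, fun hv σ hσ => ?_⟩
  refine evalComplex_eq_zero h.fderiv_ne_zero (fun a ha => ?_) hv
  have h1 : HasFDerivWithinAt σ (fderiv ℝ σ p) S p :=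
    (hσ.contDiffAt.differentiableAt (by simp)).hasFDerivAt.hasFDerivWithinAt
  have h2 : HasFDerivWithinAt σ (0 : ℂ × ℂ →L[ℝ] ℝ) S p := by
    refine (hasFDerivWithinAt_const (0 : ℝ) p S).congr_of_eventuallyEq ?_
      (hσ.eventually_mem_iff.self_of_nhds.1 hp)
    filter_upwards [self_mem_nhdsWithin, nhdsWithin_le_nhds hσ.eventually_mem_iff] with z hz hz'
    exact hz'.1 hz
  rw [ContinuousLinearMap.comp_apply, h.hasFDerivWithinAt_unique hp h1 h2 ha]
  simp

lemma evalComplex_real (D : ℂ × ℂ →L[ℝ] ℝ) (a : ℂ × ℂ) :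
    evalComplex (Complex.ofRealCLM.comp D) (a, 0) = (D a - Complex.I * D (Complex.I • a)) / 2 :=
  evalComplex_holomorphic _ _

/-- For real `D`, the `(1,0)` vector of `a` is killed by `D` exactly when `a` and `i a` are. -/
lemma evalComplex_real_eq_zero_iff (D : ℂ × ℂ →L[ℝ] ℝ) (a : ℂ × ℂ) :
    evalComplex (Complex.ofRealCLM.comp D) (a, 0) = 0 ↔ D a = 0 ∧ D (Complex.I • a) = 0 := by
  rw [evalComplex_real, div_eq_zero_iff, Complex.ext_iff]
  simp

lemma mem_complexTangentSpace_iff {S : Set (ℂ × ℂ)} {p a : ℂ × ℂ} :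
    a ∈ complexTangentSpace S p ↔ IsTangentVector S p (a, 0) := by
  simp only [complexTangentSpace, IsTangentVector, Set.mem_ofPred_eq, evalComplex_real_eq_zero_iff]

/-- The derivatives of `u` within `S` all agree on `T_p S ⊗ ℂ`. -/
lemma evalComplex_fderivWithin {S : Set (ℂ × ℂ)} (hS : IsRealHypersurface S) {p : ℂ × ℂ}
    (hp : p ∈ S) {u : ℂ × ℂ → ℂ} {L : ℂ × ℂ →L[ℝ] ℂ} (hu : HasFDerivWithinAt u L S p)
    {v : ComplexVector} (hv : IsTangentVector S p v) :
    evalComplex (fderivWithin ℝ u S p) v = evalComplex L v := by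
  obtain ⟨ρ, hρ⟩ := hS p hp
  rw [← sub_eq_zero, ← evalComplex_sub]
  refine evalComplex_eq_zero hρ.fderiv_ne_zero (fun a ha => ?_) (hv ρ hρ)
  rw [sub_apply, sub_eq_zero]
  exact hρ.hasFDerivWithinAt_unique hp hu.differentiableWithinAt.hasFDerivWithinAt hu ha

/-! ### Smooth functions on a subset -/

section Smooth

variable {E F : Type*} [NormedAddCommGroup E] [NormedSpace ℝ E] [NormedAddCommGroup F]
  [NormedSpace ℝ F] {S : Set (ℂ × ℂ)}

lemma ContDiff.isSmoothOn {f : ℂ × ℂ → E} (hf : ContDiff ℝ ∞ f) : IsSmoothOn S f :=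
  fun _ _ => ⟨Set.univ, isOpen_univ, trivial, f, hf.contDiffOn, fun _ _ => rfl⟩

lemma IsSmoothOn.comp {f : ℂ × ℂ → E} (hf : IsSmoothOn S f) {V : Set E} (hV : IsOpen V)
    {Φ : E → F} (hΦ : ContDiffOn ℝ ∞ Φ V) (hfV : Set.MapsTo f S V) :
    IsSmoothOn S (fun z => Φ (f z)) := fun p hp => by
  obtain ⟨U, hU, hpU, k, hk, hkf⟩ := hf p hp
  refine ⟨U ∩ k ⁻¹' V, hk.continuousOn.isOpen_inter_preimage hU hV, ⟨hpU, ?_⟩, Φ ∘ k,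
    hΦ.comp (hk.mono Set.inter_subset_left) fun z hz => hz.2, fun z hz => ?_⟩
  · rw [Set.mem_preimage, hkf ⟨hp, hpU⟩]
    exact hfV hp
  · simp only [Function.comp_apply, hkf ⟨hz.1, hz.2.1⟩]

lemma IsSmoothOn.contDiff_comp {f : ℂ × ℂ → E} (hf : IsSmoothOn S f) {Φ : E → F}
    (hΦ : ContDiff ℝ ∞ Φ) : IsSmoothOn S (fun z => Φ (f z)) :=
  hf.comp isOpen_univ hΦ.contDiffOn fun _ _ => trivial

lemma IsSmoothOn.prodMk {f : ℂ × ℂ → E} {g : ℂ × ℂ → F} (hf : IsSmoothOn S f)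
    (hg : IsSmoothOn S g) : IsSmoothOn S (fun z => (f z, g z)) := fun p hp => by
  obtain ⟨U, hU, hpU, k, hk, hkf⟩ := hf p hp
  obtain ⟨V, hV, hpV, l, hl, hlg⟩ := hg p hp
  refine ⟨U ∩ V, hU.inter hV, ⟨hpU, hpV⟩, fun z => (k z, l z),
    (hk.mono Set.inter_subset_left).prodMk (hl.mono Set.inter_subset_right), fun z hz => ?_⟩
  simp only [hkf ⟨hz.1, hz.2.1⟩, hlg ⟨hz.1, hz.2.2⟩]

lemma IsSmoothOn.fst {f : ℂ × ℂ → E × F} (hf : IsSmoothOn S f) :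
    IsSmoothOn S (fun z => (f z).1) := hf.contDiff_comp contDiff_fst

lemma IsSmoothOn.snd {f : ℂ × ℂ → E × F} (hf : IsSmoothOn S f) :
    IsSmoothOn S (fun z => (f z).2) := hf.contDiff_comp contDiff_snd

lemma IsSmoothOn.mul {f g : ℂ × ℂ → ℂ} (hf : IsSmoothOn S f) (hg : IsSmoothOn S g) :
    IsSmoothOn S (fun z => f z * g z) :=
  (hf.prodMk hg).contDiff_comp (contDiff_fst.mul contDiff_snd)

lemma IsSmoothOn.sub {f g : ℂ × ℂ → ℂ} (hf : IsSmoothOn S f) (hg : IsSmoothOn S g) :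
    IsSmoothOn S (fun z => f z - g z) :=
  (hf.prodMk hg).contDiff_comp (contDiff_fst.sub contDiff_snd)

lemma IsSmoothOn.neg {f : ℂ × ℂ → ℂ} (hf : IsSmoothOn S f) : IsSmoothOn S (fun z => -f z) :=
  hf.contDiff_comp contDiff_neg

lemma IsSmoothOn.inv {f : ℂ × ℂ → ℂ} (hf : IsSmoothOn S f) (h : ∀ z ∈ S, f z ≠ 0) :
    IsSmoothOn S (fun z => (f z)⁻¹) :=
  hf.comp isOpen_compl_singleton
    (fun _ hz => (contDiffAt_inv ℝ hz).contDiffWithinAt) h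

lemma IsSmoothOn.hasFDerivWithinAt {f : ℂ × ℂ → E} (hf : IsSmoothOn S f) {p : ℂ × ℂ}
    (hp : p ∈ S) : HasFDerivWithinAt f (fderivWithin ℝ f S p) S p := by
  obtain ⟨U, hU, hpU, k, hk, hkf⟩ := hf p hp
  have h1 : DifferentiableWithinAt ℝ k S p :=
    ((hk.contDiffAt (hU.mem_nhds hpU)).differentiableAt (by simp)).differentiableWithinAt
  refine (h1.congr_of_eventuallyEq ?_ (hkf ⟨hp, hpU⟩).symm).hasFDerivWithinAt
  filter_upwards [self_mem_nhdsWithin, nhdsWithin_le_nhds (hU.mem_nhds hpU)] with z hz hz'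
  exact (hkf ⟨hz, hz'⟩).symm

end Smooth

lemma contDiff_evalComplex :
    ContDiff ℝ ∞ (fun q : (ℂ × ℂ →L[ℝ] ℂ) × ComplexVector => evalComplex q.1 q.2) := by
  unfold evalComplex
  fun_prop

/-! ### Tangential vector fields as derivations -/

section Field

variable {S : Set (ℂ × ℂ)} {X : ℂ × ℂ → ComplexVector} {u v : ℂ × ℂ → ℂ} {p : ℂ × ℂ}

lemma applyField_congr (h : Set.EqOn u v S) (hp : p ∈ S) :
    applyField S X u p = applyField S X v p := by
  rw [applyField, applyField, fderivWithin_congr h (h hp)]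

lemma applyField_eq (hS : IsRealHypersurface S) (hX : IsTangentVector S p (X p)) (hp : p ∈ S)
    {L : ℂ × ℂ →L[ℝ] ℂ} (hu : HasFDerivWithinAt u L S p) :
    applyField S X u p = evalComplex L (X p) :=
  evalComplex_fderivWithin hS hp hu hX

lemma applyField_mul (hS : IsRealHypersurface S) (hX : IsTangentVector S p (X p)) (hp : p ∈ S)
    (hu : IsSmoothOn S u) (hv : IsSmoothOn S v) :
    applyField S X (fun z => u z * v z) p
      = applyField S X u p * v p + u p * applyField S X v p := by
  rw [applyField_eq hS hX hp (u := fun z => u z * v z)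
    ((hu.hasFDerivWithinAt hp).mul (hv.hasFDerivWithinAt hp))]
  simp only [applyField, evalComplex, add_apply, smul_apply,
    smul_eq_mul]
  ring

lemma applyField_sub (hS : IsRealHypersurface S) (hX : IsTangentVector S p (X p)) (hp : p ∈ S)
    (hu : IsSmoothOn S u) (hv : IsSmoothOn S v) :
    applyField S X (fun z => u z - v z) p = applyField S X u p - applyField S X v p := by
  rw [applyField_eq hS hX hp (u := fun z => u z - v z)
    ((hu.hasFDerivWithinAt hp).sub (hv.hasFDerivWithinAt hp)), evalComplex_sub]
  rfl

lemma applyField_const (hS : IsRealHypersurface S) (hX : IsTangentVector S p (X p)) (hp : p ∈ S)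
    (c : ℂ) : applyField S X (fun _ => c) p = 0 := by
  rw [applyField_eq hS hX hp (hasFDerivWithinAt_const c p S)]
  simp [evalComplex]

lemma applyField_neg (hS : IsRealHypersurface S) (hX : IsTangentVector S p (X p)) (hp : p ∈ S)
    (hu : IsSmoothOn S u) : applyField S X (fun z => -u z) p = -applyField S X u p := by
  have h := applyField_sub hS hX hp (contDiff_const (c := (0 : ℂ))).isSmoothOn hu
  simpa [applyField_const hS hX hp] using h

lemma applyField_fst (hS : IsRealHypersurface S) (hX : IsTangentVector S p (X p)) (hp : p ∈ S) :
    applyField S X (fun z => z.1) p = (X p).1.1 := by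
  rw [applyField_eq hS hX hp hasFDerivWithinAt_fst]
  simp [evalComplex]

lemma applyField_snd (hS : IsRealHypersurface S) (hX : IsTangentVector S p (X p)) (hp : p ∈ S) :
    applyField S X (fun z => z.2) p = (X p).1.2 := by
  rw [applyField_eq hS hX hp hasFDerivWithinAt_snd]
  simp [evalComplex]

lemma applyField_conj_fst (hS : IsRealHypersurface S) (hX : IsTangentVector S p (X p))
    (hp : p ∈ S) : applyField S X (fun z => conj z.1) p = (X p).2.1 := by
  rw [applyField_eq hS hX hp (u := fun z => conj z.1)
    ((Complex.conjCLE.hasFDerivAt (x := p.1)).comp_hasFDerivWithinAt p hasFDerivWithinAt_fst)]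
  simp [evalComplex]

lemma applyField_conj_snd (hS : IsRealHypersurface S) (hX : IsTangentVector S p (X p))
    (hp : p ∈ S) : applyField S X (fun z => conj z.2) p = (X p).2.2 := by
  rw [applyField_eq hS hX hp (u := fun z => conj z.2)
    ((Complex.conjCLE.hasFDerivAt (x := p.2)).comp_hasFDerivWithinAt p hasFDerivWithinAt_snd)]
  simp [evalComplex]

lemma IsTangentialField.isSmoothOn_applyField (hS : IsRealHypersurface S)
    (hX : IsTangentialField S X) (hu : IsSmoothOn S u) : IsSmoothOn S (applyField S X u) := by
  intro p hp
  obtain ⟨U, hU, hpU, k, hk, hkX⟩ := hX.1 p hp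
  obtain ⟨V, hV, hpV, l, hl, hlu⟩ := hu p hp
  refine ⟨U ∩ V, hU.inter hV, ⟨hpU, hpV⟩, fun z => evalComplex (fderiv ℝ l z) (k z),
    contDiff_evalComplex.comp_contDiffOn (ContDiffOn.prodMk ?_ (hk.mono Set.inter_subset_left)),
    fun z hz => ?_⟩
  · exact (hl.fderiv_of_isOpen hV (by simp)).mono Set.inter_subset_right
  · have h1 : HasFDerivWithinAt l (fderiv ℝ l z) S z :=
      ((hl.contDiffAt (hV.mem_nhds hz.2.2)).differentiableAt
        (by simp)).hasFDerivAt.hasFDerivWithinAt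
    have h2 : HasFDerivWithinAt u (fderiv ℝ l z) S z := by
      refine h1.congr_of_eventuallyEq ?_ (hlu ⟨hz.1, hz.2.2⟩).symm
      filter_upwards [self_mem_nhdsWithin, nhdsWithin_le_nhds (hV.mem_nhds hz.2.2)] with y hy hy'
      exact (hlu ⟨hy, hy'⟩).symm
    rw [applyField_eq hS (hX.2 z hz.1) hz.1 h2, ← hkX ⟨hz.1, hz.2.1⟩]

end Field

/-! ### The dual map and the fields `Y`, `Ȳ` -/

lemma isTangentVector_conj {S : Set (ℂ × ℂ)} {p : ℂ × ℂ} {v : ComplexVector}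
    (hv : IsTangentVector S p v) :
    IsTangentVector S p ((conj v.2.1, conj v.2.2), (conj v.1.1, conj v.1.2)) := fun ρ hρ => by
  rw [← evalComplex_conj, hv ρ hρ, map_zero]

/-- The holomorphic gradient `(∂ρ/∂z₁, ∂ρ/∂z₂)`. -/
noncomputable def holGradient (ρ : ℂ × ℂ → ℝ) (z : ℂ × ℂ) : ℂ × ℂ :=
  (evalComplex (Complex.ofRealCLM.comp (fderiv ℝ ρ z)) ((1, 0), 0),
    evalComplex (Complex.ofRealCLM.comp (fderiv ℝ ρ z)) ((0, 1), 0))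

lemma evalComplex_fderiv_eq_holGradient (ρ : ℂ × ℂ → ℝ) (z a : ℂ × ℂ) :
    evalComplex (Complex.ofRealCLM.comp (fderiv ℝ ρ z)) (a, 0)
      = a.1 * (holGradient ρ z).1 + a.2 * (holGradient ρ z).2 := by
  simp [holGradient, evalComplex]

lemma ContDiffOn.holGradient {ρ : ℂ × ℂ → ℝ} {U : Set (ℂ × ℂ)} (hρ : ContDiffOn ℝ ∞ ρ U)
    (hU : IsOpen U) : ContDiffOn ℝ ∞ (holGradient ρ) U := by
  have h : ContDiff ℝ ∞ (fun D : ℂ × ℂ →L[ℝ] ℝ =>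
      (evalComplex (Complex.ofRealCLM.comp D) ((1, 0), 0),
        evalComplex (Complex.ofRealCLM.comp D) ((0, 1), 0))) := by
    simp only [evalComplex, ContinuousLinearMap.comp_apply]
    fun_prop
  exact h.comp_contDiffOn (hρ.fderiv_of_isOpen hU (by simp))

section DualMap

variable {S : Set (ℂ × ℂ)} {p : ℂ × ℂ} {ρ : ℂ × ℂ → ℝ}

/-- If `z · ∂ρ` vanished at `p`, then `-p` would lie in `H_p S`. -/
lemma IsLocalDefiningFunction.euler_ne_zero (h : IsLocalDefiningFunction S p ρ) (hp : p ∈ S)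
    (h0 : NoTangentLineThroughOrigin S) :
    p.1 * (holGradient ρ p).1 + p.2 * (holGradient ρ p).2 ≠ 0 := fun hs => by
  refine h0 p hp ⟨-p, mem_complexTangentSpace_iff.2 ((h.isTangentVector_iff hp).2 ?_), by simp⟩
  rw [evalComplex_fderiv_eq_holGradient, Prod.fst_neg, Prod.snd_neg]
  linear_combination -hs

lemma IsLocalDefiningFunction.dualMap_spec (h : IsLocalDefiningFunction S p ρ) (hp : p ∈ S)
    (h0 : NoTangentLineThroughOrigin S) :
    p.1 * (dualMap S p).1 + p.2 * (dualMap S p).2 = 1 ∧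
      IsTangentVector S p (((dualMap S p).2, -(dualMap S p).1), 0) := by
  have hs := h.euler_ne_zero hp h0
  refine Classical.epsilon_spec (p := fun w : ℂ × ℂ =>
    p.1 * w.1 + p.2 * w.2 = 1 ∧ IsTangentVector S p ((w.2, -w.1), 0))
    ⟨((holGradient ρ p).1 / (p.1 * (holGradient ρ p).1 + p.2 * (holGradient ρ p).2),
      (holGradient ρ p).2 / (p.1 * (holGradient ρ p).1 + p.2 * (holGradient ρ p).2)), ?_, ?_⟩
  · field_simp
  · rw [h.isTangentVector_iff hp, evalComplex_fderiv_eq_holGradient]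
    ring

/-- The gradient is `∂ρ = (z · ∂ρ) w`. -/
lemma IsLocalDefiningFunction.holGradient_eq (h : IsLocalDefiningFunction S p ρ) (hp : p ∈ S)
    (h0 : NoTangentLineThroughOrigin S) :
    holGradient ρ p
      = (p.1 * (holGradient ρ p).1 + p.2 * (holGradient ρ p).2) • dualMap S p := by
  obtain ⟨h1, h2⟩ := h.dualMap_spec hp h0
  rw [h.isTangentVector_iff hp, evalComplex_fderiv_eq_holGradient] at h2
  ext
  · simp only [Prod.smul_fst, smul_eq_mul]
    linear_combination -(holGradient ρ p).1 * h1 + p.2 * h2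
  · simp only [Prod.smul_snd, smul_eq_mul]
    linear_combination -(holGradient ρ p).2 * h1 - p.1 * h2

lemma dualMap_mul_eq_one (hS : IsRealHypersurface S) (h0 : NoTangentLineThroughOrigin S)
    (hp : p ∈ S) : p.1 * (dualMap S p).1 + p.2 * (dualMap S p).2 = 1 := by
  obtain ⟨ρ, hρ⟩ := hS p hp
  exact (hρ.dualMap_spec hp h0).1

lemma isTangentVector_fieldY (hS : IsRealHypersurface S) (h0 : NoTangentLineThroughOrigin S)
    (hp : p ∈ S) : IsTangentVector S p (fieldY S p) := by
  obtain ⟨ρ, hρ⟩ := hS p hp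
  exact (hρ.dualMap_spec hp h0).2

lemma isTangentVector_fieldYbar (hS : IsRealHypersurface S) (h0 : NoTangentLineThroughOrigin S)
    (hp : p ∈ S) : IsTangentVector S p (fieldYbar S p) := by
  have h := isTangentVector_conj (isTangentVector_fieldY hS h0 hp)
  simp only [fieldY, Prod.fst_zero, Prod.snd_zero, map_zero, map_neg] at h
  exact h

lemma isSmoothOn_dualMap (hS : IsRealHypersurface S) (h0 : NoTangentLineThroughOrigin S) :
    IsSmoothOn S (dualMap S) := by
  intro p hp
  obtain ⟨ρ, hρ⟩ := hS p hp
  obtain ⟨U, hU, hpU, hρU, hdρ, hSU⟩ := id hρ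
  have hg := hρU.holGradient hU
  have hs : ContDiffOn ℝ ∞
      (fun z => z.1 * (holGradient ρ z).1 + z.2 * (holGradient ρ z).2) U :=
    (contDiff_fst.contDiffOn.mul hg.fst).add (contDiff_snd.contDiffOn.mul hg.snd)
  refine ⟨_, hs.continuousOn.isOpen_inter_preimage hU isOpen_compl_singleton,
    ⟨hpU, hρ.euler_ne_zero hp h0⟩, fun z => (z.1 * (holGradient ρ z).1
      + z.2 * (holGradient ρ z).2)⁻¹ • holGradient ρ z,
    ((hs.mono Set.inter_subset_left).inv fun z hz => hz.2).smul (hg.mono Set.inter_subset_left),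
    fun z hz => ?_⟩
  have hz' : IsLocalDefiningFunction S z ρ := ⟨U, hU, hz.2.1, hρU, hdρ, hSU⟩
  dsimp only
  nth_rewrite 3 [hz'.holGradient_eq hz.1 h0]
  rw [smul_smul, inv_mul_cancel₀ (hz'.euler_ne_zero hz.1 h0), one_smul]

/-- Tangential vectors of type `(1,0)` are multiples of `Y`. -/
lemma eq_smul_fieldY (hS : IsRealHypersurface S) (h0 : NoTangentLineThroughOrigin S)
    (hp : p ∈ S) {a : ℂ × ℂ} (ha : IsTangentVector S p (a, 0)) :
    ((a, 0) : ComplexVector) = (p.2 * a.1 - p.1 * a.2) • fieldY S p := by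
  obtain ⟨ρ, hρ⟩ := hS p hp
  have h1 := (hρ.dualMap_spec hp h0).1
  rw [hρ.isTangentVector_iff hp, evalComplex_fderiv_eq_holGradient, hρ.holGradient_eq hp h0] at ha
  have h2 : a.1 * (dualMap S p).1 + a.2 * (dualMap S p).2 = 0 := by
    refine (mul_eq_zero.1 ?_).resolve_left (hρ.euler_ne_zero hp h0)
    rw [← ha]
    simp only [Prod.smul_fst, Prod.smul_snd, smul_eq_mul]
    ring
  ext
  · simp only [fieldY, Prod.smul_fst, smul_eq_mul]
    linear_combination -a.1 * h1 + p.1 * h2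
  · simp only [fieldY, Prod.smul_fst, Prod.smul_snd, smul_eq_mul]
    linear_combination -a.2 * h1 + p.2 * h2
  all_goals simp [fieldY]

/-- Tangential vectors of type `(0,1)` are multiples of `Ȳ`. -/
lemma eq_smul_fieldYbar (hS : IsRealHypersurface S) (h0 : NoTangentLineThroughOrigin S)
    (hp : p ∈ S) {b : ℂ × ℂ} (hb : IsTangentVector S p (0, b)) :
    ((0, b) : ComplexVector) = (conj p.2 * b.1 - conj p.1 * b.2) • fieldYbar S p := by
  have hb' : IsTangentVector S p ((conj b.1, conj b.2), 0) := by
    have h := isTangentVector_conj hb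
    simp only [Prod.fst_zero, Prod.snd_zero, map_zero] at h
    exact h
  have h := eq_smul_fieldY hS h0 hp hb'
  have h1 := congrArg (fun v : ComplexVector => conj v.1.1) h
  have h2 := congrArg (fun v : ComplexVector => conj v.1.2) h
  simp [fieldY] at h1 h2
  ext
  · simp [fieldYbar]
  · simp [fieldYbar]
  · simpa [fieldYbar] using h1
  · simpa [fieldYbar] using h2

end DualMap

/-! ### The Levi form and the derivatives of the dual map -/

/-- The mixed second derivative of `ρ` in the directions `a · ∂/∂z` and `ā · ∂/∂z̄` is the Levi
form. -/
lemma IsLocalDefiningFunction.evalComplex_fderiv_holGradient {S : Set (ℂ × ℂ)} {p : ℂ × ℂ}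
    {ρ : ℂ × ℂ → ℝ} (h : IsLocalDefiningFunction S p ρ) (a : ℂ × ℂ) : ∃ L : ℂ × ℂ →L[ℝ] ℂ,
      HasFDerivAt (fun z => a.1 * (holGradient ρ z).1 + a.2 * (holGradient ρ z).2) L p ∧
      evalComplex L (0, (conj a.1, conj a.2)) = leviForm ρ p a := by
  have hsymm : IsSymmSndFDerivAt ℝ ρ p := h.contDiffAt.isSymmSndFDerivAt (by
    rw [minSmoothness_of_isRCLikeNormedField]
    exact WithTop.coe_le_coe.2 le_top)
  have hd : HasFDerivAt (fderiv ℝ ρ) (fderiv ℝ (fderiv ℝ ρ) p) p :=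
    ((h.contDiffAt.fderiv_right (m := 1) (by norm_cast)).differentiableAt (by simp)).hasFDerivAt
  have hdir : ∀ b, HasFDerivAt (fun z => (fderiv ℝ ρ z b : ℂ))
      (Complex.ofRealCLM.comp ((fderiv ℝ (fderiv ℝ ρ) p).flip b)) p := fun b => by
    have h1 : HasFDerivAt (fun z => fderiv ℝ ρ z b) ((fderiv ℝ (fderiv ℝ ρ) p).flip b) p :=
      (ContinuousLinearMap.apply ℝ ℝ b).hasFDerivAt.comp p hd
    exact (Complex.ofRealCLM.hasFDerivAt (x := fderiv ℝ ρ p b)).comp p h1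
  have hL := ((hdir a).sub ((hdir (Complex.I • a)).const_mul Complex.I)).mul_const (2⁻¹ : ℂ)
  refine ⟨_, hL.congr_of_eventuallyEq (Eventually.of_forall fun z => ?_), ?_⟩
  · simp only [← evalComplex_fderiv_eq_holGradient, evalComplex_real, div_eq_mul_inv]
    rfl
  · rw [evalComplex_antiholomorphic, leviForm]
    have hs := hsymm.eq a (Complex.I • a)
    simp [-Prod.smul_mk, hs]
    linear_combination (-(fderiv ℝ (fderiv ℝ ρ) p (Complex.I • a) (Complex.I • a) : ℂ) / 4) *
      Complex.I_sq

section LeviCoefficient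

variable {S : Set (ℂ × ℂ)} {p : ℂ × ℂ}

/-- The function `β` with `Ȳ w₁ = β z₂` and `Ȳ w₂ = -β z₁`; it is the Levi form of `S` in the
direction `(w₂, -w₁)`, up to a nonvanishing factor. -/
noncomputable def leviCoefficient (S : Set (ℂ × ℂ)) (z : ℂ × ℂ) : ℂ :=
  (dualMap S z).2 * applyField S (fieldYbar S) (fun ζ => (dualMap S ζ).1) z
    - (dualMap S z).1 * applyField S (fieldYbar S) (fun ζ => (dualMap S ζ).2) z

lemma applyField_fieldYbar_dualMap (hS : IsRealHypersurface S) (h0 : NoTangentLineThroughOrigin S)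
    (hp : p ∈ S) :
    applyField S (fieldYbar S) (fun ζ => (dualMap S ζ).1) p = leviCoefficient S p * p.2 ∧
      applyField S (fieldYbar S) (fun ζ => (dualMap S ζ).2) p = leviCoefficient S p * -p.1 := by
  have ht := isTangentVector_fieldYbar hS h0 hp
  have hw := isSmoothOn_dualMap hS h0
  have h1 := dualMap_mul_eq_one hS h0 hp
  have hz1 : IsSmoothOn S (fun z : ℂ × ℂ => z.1) := contDiff_fst.isSmoothOn
  have hz2 : IsSmoothOn S (fun z : ℂ × ℂ => z.2) := contDiff_snd.isSmoothOn
  have h2 : p.1 * applyField S (fieldYbar S) (fun ζ => (dualMap S ζ).1) p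
      + p.2 * applyField S (fieldYbar S) (fun ζ => (dualMap S ζ).2) p = 0 := by
    have h := applyField_congr (X := fieldYbar S) (p := p)
      (u := fun z => z.1 * (dualMap S z).1 - -(z.2 * (dualMap S z).2)) (v := fun _ => (1 : ℂ))
      (fun z hz => by
        dsimp only
        rw [sub_neg_eq_add, dualMap_mul_eq_one hS h0 hz]) hp
    rw [applyField_sub hS ht hp (hz1.mul hw.fst) (hz2.mul hw.snd).neg,
      applyField_neg hS ht hp (hz2.mul hw.snd), applyField_mul hS ht hp hz1 hw.fst,
      applyField_mul hS ht hp hz2 hw.snd, applyField_fst hS ht hp, applyField_snd hS ht hp,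
      applyField_const hS ht hp] at h
    simp only [fieldYbar, Prod.fst_zero, Prod.snd_zero] at h
    linear_combination h
  rw [leviCoefficient]
  constructor
  · linear_combination (dualMap S p).1 * h2
      - applyField S (fieldYbar S) (fun ζ => (dualMap S ζ).1) p * h1
  · linear_combination (dualMap S p).2 * h2
      - applyField S (fieldYbar S) (fun ζ => (dualMap S ζ).2) p * h1

/-- Differentiating `∂ρ = (z · ∂ρ) w` along `Ȳ` expresses the Levi form in the direction
`(w₂, -w₁)` as `(z · ∂ρ) β`. -/
lemma leviCoefficient_ne_zero (hS : IsStronglyPseudoconvex S) (h0 : NoTangentLineThroughOrigin S)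
    (hp : p ∈ S) : leviCoefficient S p ≠ 0 := by
  obtain ⟨ρ, hρ, hlevi⟩ := hS.2 p hp
  have hw := isSmoothOn_dualMap hS.1 h0
  have ht := isTangentVector_fieldYbar hS.1 h0 hp
  have h1 := dualMap_mul_eq_one hS.1 h0 hp
  set a : ℂ × ℂ := ((dualMap S p).2, -(dualMap S p).1) with ha
  have ha0 : a ≠ 0 := fun h => by
    have e1 : (dualMap S p).2 = 0 := congrArg Prod.fst h
    have e2 : (dualMap S p).1 = 0 := neg_eq_zero.1 (congrArg Prod.snd h)
    simp [e1, e2] at h1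
  have hpos := hlevi a (mem_complexTangentSpace_iff.2 (isTangentVector_fieldY hS.1 h0 hp)) ha0
  obtain ⟨L, hL, hLa⟩ := hρ.evalComplex_fderiv_holGradient a
  have hyb : fieldYbar S p = (0, (conj a.1, conj a.2)) := by simp [fieldYbar, ha]
  obtain ⟨L₁, hL₁, -⟩ := hρ.evalComplex_fderiv_holGradient (1, 0)
  obtain ⟨L₂, hL₂, -⟩ := hρ.evalComplex_fderiv_holGradient (0, 1)
  simp only [one_mul, zero_mul, add_zero, zero_add] at hL₁ hL₂
  set s : ℂ × ℂ → ℂ := fun z => z.1 * (holGradient ρ z).1 + z.2 * (holGradient ρ z).2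
  obtain ⟨Ls, hs⟩ : ∃ Ls, HasFDerivAt s Ls p :=
    ⟨_, ((hasFDerivAt_fst (𝕜 := ℝ) (p := p)).mul hL₁).add
      ((hasFDerivAt_snd (𝕜 := ℝ) (p := p)).mul hL₂)⟩
  have hw1 := hw.fst.hasFDerivWithinAt hp
  have hw2 := hw.snd.hasFDerivWithinAt hp
  have hM := hs.hasFDerivWithinAt.mul ((hw1.const_mul a.1).add (hw2.const_mul a.2))
  have hLS : HasFDerivWithinAt (fun z => s z * (a.1 * (dualMap S z).1 + a.2 * (dualMap S z).2))
      L S p := by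
    have heq : ∀ z ∈ S, IsLocalDefiningFunction S z ρ →
        s z * (a.1 * (dualMap S z).1 + a.2 * (dualMap S z).2)
          = a.1 * (holGradient ρ z).1 + a.2 * (holGradient ρ z).2 := fun z hz hz' => by
      have e := hz'.holGradient_eq hz h0
      have e1 : (holGradient ρ z).1 = s z * (dualMap S z).1 := congrArg Prod.fst e
      have e2 : (holGradient ρ z).2 = s z * (dualMap S z).2 := congrArg Prod.snd e
      rw [e1, e2]
      ring
    refine hL.hasFDerivWithinAt.congr_of_eventuallyEq ?_ (heq p hp hρ)
    filter_upwards [self_mem_nhdsWithin, nhdsWithin_le_nhds hρ.eventually] with z hz hz'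
    exact heq z hz hz'
  have h2 := (evalComplex_fderivWithin hS.1 hp hLS ht).symm.trans
    (evalComplex_fderivWithin hS.1 hp hM ht)
  rw [hyb, hLa, ← hyb] at h2
  have h3 : (leviForm ρ p a : ℂ) = s p * leviCoefficient S p := by
    rw [h2, leviCoefficient]
    simp only [evalComplex, applyField, Pi.add_apply, add_apply, smul_apply, smul_eq_mul, ha]
    ring
  intro hzero
  rw [hzero, mul_zero, Complex.ofReal_eq_zero] at h3
  exact hpos.ne' h3

lemma scalarAlpha_eq_inv (hS : IsStronglyPseudoconvex S) (h0 : NoTangentLineThroughOrigin S)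
    (hp : p ∈ S) : scalarAlpha S p = (leviCoefficient S p)⁻¹ := by
  have hb := leviCoefficient_ne_zero hS h0 hp
  have h1 := dualMap_mul_eq_one hS.1 h0 hp
  obtain ⟨e1, e2⟩ := applyField_fieldYbar_dualMap hS.1 h0 hp
  have hα : scalarAlpha S p * applyField S (fieldYbar S) (fun ζ => (dualMap S ζ).1) p = p.2 ∧
      scalarAlpha S p * applyField S (fieldYbar S) (fun ζ => (dualMap S ζ).2) p = -p.1 := by
    refine Classical.epsilon_spec (p := fun α : ℂ =>
      α * applyField S (fieldYbar S) (fun ζ => (dualMap S ζ).1) p = p.2 ∧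
      α * applyField S (fieldYbar S) (fun ζ => (dualMap S ζ).2) p = -p.1)
      ⟨(leviCoefficient S p)⁻¹, ?_, ?_⟩
    · rw [e1, inv_mul_cancel_left₀ hb]
    · rw [e2, inv_mul_cancel_left₀ hb]
  rw [e1, e2] at hα
  refine eq_inv_of_mul_eq_one_left ?_
  linear_combination (dualMap S p).2 * hα.1 - (dualMap S p).1 * hα.2
    + (1 - scalarAlpha S p * leviCoefficient S p) * h1

end LeviCoefficient

/-! ### Fields annihilating the CR functions -/

lemma isCR_fst {S : Set (ℂ × ℂ)} (hS : IsRealHypersurface S) : IsCR S (fun z => z.1) :=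
  ⟨contDiff_fst.isSmoothOn, fun p hp b hb => by
    rw [evalComplex_fderivWithin hS hp hasFDerivWithinAt_fst hb]
    simp [evalComplex]⟩

lemma isCR_snd {S : Set (ℂ × ℂ)} (hS : IsRealHypersurface S) : IsCR S (fun z => z.2) :=
  ⟨contDiff_snd.isSmoothOn, fun p hp b hb => by
    rw [evalComplex_fderivWithin hS hp hasFDerivWithinAt_snd hb]
    simp [evalComplex]⟩

/-- A quotient of two functions annihilated by a tangential field is annihilated by it. -/
lemma applyField_mul_inv_eq_zero {S : Set (ℂ × ℂ)} {X : ℂ × ℂ → ComplexVector} {k f : ℂ × ℂ → ℂ}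
    {p : ℂ × ℂ} (hS : IsRealHypersurface S) (hX : IsTangentVector S p (X p)) (hp : p ∈ S)
    (hk : IsSmoothOn S k) (hf : IsSmoothOn S f) (hf0 : ∀ z ∈ S, f z ≠ 0)
    (hk' : applyField S X k p = 0) (hf' : applyField S X f p = 0) :
    applyField S X (fun z => k z * (f z)⁻¹) p = 0 := by
  have h := applyField_mul hS hX hp (hk.mul (hf.inv hf0)) hf
  rw [applyField_congr (v := k) (fun z hz => inv_mul_cancel_right₀ (hf0 z hz) (k z)) hp, hk', hf',
    mul_zero, add_zero] at h
  exact (mul_eq_zero.1 h.symm).resolve_right (hf0 p hp)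

theorem theorem5p2 (S : Set (ℂ × ℂ))
    (hS : IsStronglyPseudoconvex S) (hcirc : IsCircular S)
    (h0 : NoTangentLineThroughOrigin S)
    (X' Y' : ℂ × ℂ → ComplexVector)
    (hX' : IsTangentialField S X') (hX'0 : ∀ p ∈ S, X' p ≠ 0)
    (hY' : IsTangentialField S Y') (hY'0 : ∀ p ∈ S, Y' p ≠ 0)
    (hXCR : ∀ O : Set (ℂ × ℂ), IsOpen O → ∀ u : ℂ × ℂ → ℂ, IsSmoothOn (S ∩ O) u →
      (IsCR (S ∩ O) u ↔ ∀ p ∈ S ∩ O, applyField (S ∩ O) X' u p = 0))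
    (hYCR : ∀ O : Set (ℂ × ℂ), IsOpen O → ∀ u : ℂ × ℂ → ℂ, IsSmoothOn (S ∩ O) u →
      (IsCR (S ∩ O) u ↔
        ∀ p ∈ S ∩ O, applyField (S ∩ O) Y' (fun z => starRingEnd ℂ (u z)) p = 0))
    (hann : ∀ u : ℂ × ℂ → ℂ, IsCR S u ∨ IsConjCR S u →
      ∀ p ∈ S, applyField S X' (applyField S X' (applyField S Y' u)) p = 0) :
    ∃ f₁ f₂ f₃ : ℂ × ℂ → ℂ, IsCR S f₁ ∧ IsCR S f₂ ∧ IsCR S f₃ ∧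
      ∀ p ∈ S,
        f₁ p * (dualMap S p).1 + f₂ p * (dualMap S p).2 ≠ 0 ∧ f₃ p ≠ 0 ∧
        X' p = (f₃ p * (f₁ p * (dualMap S p).1 + f₂ p * (dualMap S p).2) ^ 2) • fieldX S p ∧
        Y' p = (f₁ p * (dualMap S p).1 + f₂ p * (dualMap S p).2)⁻¹ • fieldY S p := by
  have hH := hS.1
  replace hXCR := hXCR Set.univ isOpen_univ
  replace hYCR := hYCR Set.univ isOpen_univ
  simp only [Set.inter_univ] at hXCR hYCR
  have hXt := hX'.2
  have hYt := hY'.2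
  have hw := isSmoothOn_dualMap hH h0
  have hz1 : IsSmoothOn S (fun z : ℂ × ℂ => z.1) := contDiff_fst.isSmoothOn
  have hz2 : IsSmoothOn S (fun z : ℂ × ℂ => z.2) := contDiff_snd.isSmoothOn
  -- `X'` annihilates the coordinates and `Y'` their conjugates, so `X'` has type `(0,1)` and `Y'`
  -- has type `(1,0)`.
  have hX1 : ∀ p ∈ S, (X' p).1.1 = 0 := fun p hp => by
    rw [← applyField_fst hH (hXt p hp) hp]
    exact (hXCR _ hz1).1 (isCR_fst hH) p hp
  have hX2 : ∀ p ∈ S, (X' p).1.2 = 0 := fun p hp => by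
    rw [← applyField_snd hH (hXt p hp) hp]
    exact (hXCR _ hz2).1 (isCR_snd hH) p hp
  have hY1 : ∀ p ∈ S, (Y' p).2.1 = 0 := fun p hp => by
    rw [← applyField_conj_fst hH (hYt p hp) hp]
    exact (hYCR _ hz1).1 (isCR_fst hH) p hp
  have hY2 : ∀ p ∈ S, (Y' p).2.2 = 0 := fun p hp => by
    rw [← applyField_conj_snd hH (hYt p hp) hp]
    exact (hYCR _ hz2).1 (isCR_snd hH) p hp
  set G : ℂ × ℂ → ℂ := fun z => z.2 * (Y' z).1.1 - z.1 * (Y' z).1.2 with hG_def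
  have hG : IsSmoothOn S G := (hz2.mul hY'.1.fst.fst).sub (hz1.mul hY'.1.fst.snd)
  have hYG : ∀ p ∈ S, Y' p = G p • fieldY S p := fun p hp => by
    have e : Y' p = ((Y' p).1, 0) := Prod.ext rfl (Prod.ext (hY1 p hp) (hY2 p hp))
    have ht := hYt p hp
    rw [e] at ht
    exact e.trans (eq_smul_fieldY hH h0 hp ht)
  have hG0 : ∀ p ∈ S, G p ≠ 0 := fun p hp h => hY'0 p hp (by rw [hYG p hp, h, zero_smul])
  -- `F` is the coefficient of `X'` along `X`; written through `X' w` it is visibly smooth.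
  set F : ℂ × ℂ → ℂ := fun z =>
    (dualMap S z).2 * applyField S X' (fun ζ => (dualMap S ζ).1) z
      - (dualMap S z).1 * applyField S X' (fun ζ => (dualMap S ζ).2) z with hF_def
  have hF : IsSmoothOn S F :=
    (hw.snd.mul (hX'.isSmoothOn_applyField hH hw.fst)).sub
      (hw.fst.mul (hX'.isSmoothOn_applyField hH hw.snd))
  have hXF : ∀ p ∈ S, X' p = F p • fieldX S p ∧
      applyField S X' (fun ζ => (dualMap S ζ).1) p = F p * p.2 ∧
      applyField S X' (fun ζ => (dualMap S ζ).2) p = F p * -p.1 := fun p hp => by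
    have e : X' p = (0, (X' p).2) := Prod.ext (Prod.ext (hX1 p hp) (hX2 p hp)) rfl
    have ht := hXt p hp
    rw [e] at ht
    obtain ⟨c, hc⟩ : ∃ c : ℂ, X' p = c • fieldYbar S p :=
      ⟨_, e.trans (eq_smul_fieldYbar hH h0 hp ht)⟩
    have hap : ∀ u, applyField S X' u p = c * applyField S (fieldYbar S) u p := fun u => by
      rw [applyField, hc, evalComplex_smul_right, applyField]
    have hFp : F p = c * leviCoefficient S p := by
      simp only [hF_def, hap, leviCoefficient]
      ring
    obtain ⟨e1, e2⟩ := applyField_fieldYbar_dualMap hH h0 hp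
    refine ⟨?_, by rw [hap, e1, hFp, mul_assoc], by rw [hap, e2, hFp, mul_assoc]⟩
    rw [hFp, fieldX, scalarAlpha_eq_inv hS h0 hp, smul_smul,
      mul_inv_cancel_right₀ (leviCoefficient_ne_zero hS h0 hp), hc]
  have hF0 : ∀ p ∈ S, F p ≠ 0 := fun p hp h => hX'0 p hp (by rw [(hXF p hp).1, h, zero_smul])
  set k₁ : ℂ × ℂ → ℂ := applyField S X' (applyField S Y' (fun z => z.1)) with hk₁_def
  set k₂ : ℂ × ℂ → ℂ := applyField S X' (applyField S Y' (fun z => z.2)) with hk₂_def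
  have hk₁ : IsSmoothOn S k₁ :=
    hX'.isSmoothOn_applyField hH (hY'.isSmoothOn_applyField hH hz1)
  have hk₂ : IsSmoothOn S k₂ :=
    hX'.isSmoothOn_applyField hH (hY'.isSmoothOn_applyField hH hz2)
  have hXk₁ : ∀ p ∈ S, applyField S X' k₁ p = 0 := hann _ (Or.inl (isCR_fst hH))
  have hXk₂ : ∀ p ∈ S, applyField S X' k₂ p = 0 := hann _ (Or.inl (isCR_snd hH))
  have hk₁' : ∀ p ∈ S, k₁ p = applyField S X' G p * (dualMap S p).2 - G p * F p * p.1 :=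
    fun p hp => by
      rw [hk₁_def, applyField_congr (v := fun z => G z * (dualMap S z).2) _ hp,
        applyField_mul hH (hXt p hp) hp hG hw.snd, (hXF p hp).2.2]
      · ring
      · intro z hz
        rw [applyField_fst hH (hYt z hz) hz, hYG z hz]
        rfl
  have hk₂' : ∀ p ∈ S, k₂ p = -(applyField S X' G p * (dualMap S p).1) - G p * F p * p.2 :=
    fun p hp => by
      rw [hk₂_def, applyField_congr (v := fun z => -(G z * (dualMap S z).1)) _ hp,
        applyField_neg hH (hXt p hp) hp (hG.mul hw.fst),
        applyField_mul hH (hXt p hp) hp hG hw.fst, (hXF p hp).2.1]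
      · ring
      · intro z hz
        rw [applyField_snd hH (hYt z hz) hz, hYG z hz]
        simp [fieldY]
  have hGF : ∀ p ∈ S, k₁ p * (dualMap S p).1 + k₂ p * (dualMap S p).2 = -(G p * F p) :=
    fun p hp => by
      rw [hk₁' p hp, hk₂' p hp]
      linear_combination -(G p * F p) * dualMap_mul_eq_one hH h0 hp
  -- The derivative of `G F = -(k₁ w₁ + k₂ w₂)` involves no derivative of `F`.
  have hXGF : ∀ p ∈ S, applyField S X' (fun z => G z * F z) p = -(F p * applyField S X' G p) :=
    fun p hp => by
      have hm1 := hk₁.mul hw.fst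
      have hm2 := hk₂.mul hw.snd
      rw [applyField_congr
          (v := fun z => -(k₁ z * (dualMap S z).1) - k₂ z * (dualMap S z).2) _ hp,
        applyField_sub hH (hXt p hp) hp hm1.neg hm2, applyField_neg hH (hXt p hp) hp hm1,
        applyField_mul hH (hXt p hp) hp hk₁ hw.fst, applyField_mul hH (hXt p hp) hp hk₂ hw.snd,
        hXk₁ p hp, hXk₂ p hp, (hXF p hp).2.1, (hXF p hp).2.2, hk₁' p hp, hk₂' p hp]
      · linear_combination -(F p * applyField S X' G p) * dualMap_mul_eq_one hH h0 hp
      · intro z hz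
        linear_combination hGF z hz
  set f : ℂ × ℂ → ℂ := fun z => G z * F z * G z with hf_def
  have hf : IsSmoothOn S f := (hG.mul hF).mul hG
  have hf0 : ∀ p ∈ S, f p ≠ 0 := fun p hp =>
    mul_ne_zero (mul_ne_zero (hG0 p hp) (hF0 p hp)) (hG0 p hp)
  have hXf : ∀ p ∈ S, applyField S X' f p = 0 := fun p hp => by
    rw [hf_def, applyField_mul hH (hXt p hp) hp (hG.mul hF) hG, hXGF p hp]
    ring
  have hquot : ∀ k, IsSmoothOn S k → (∀ p ∈ S, applyField S X' k p = 0) →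
      IsCR S (fun z => -(k z * (f z)⁻¹)) := fun k hk hXk => by
    have hm := hk.mul (hf.inv hf0)
    refine (hXCR _ hm.neg).2 fun p hp => ?_
    rw [applyField_neg hH (hXt p hp) hp hm, applyField_mul_inv_eq_zero hH (hXt p hp) hp hk hf hf0
      (hXk p hp) (hXf p hp), neg_zero]
  refine ⟨_, _, f, hquot k₁ hk₁ hXk₁, hquot k₂ hk₂ hXk₂, (hXCR _ hf).2 hXf, fun p hp => ?_⟩
  have hGp := hG0 p hp
  have hFp := hF0 p hp
  have hinv : -(k₁ p * (f p)⁻¹) * (dualMap S p).1 + -(k₂ p * (f p)⁻¹) * (dualMap S p).2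
      = (G p)⁻¹ := by
    have h : -(k₁ p * (f p)⁻¹) * (dualMap S p).1 + -(k₂ p * (f p)⁻¹) * (dualMap S p).2
        = (G p * F p) * (f p)⁻¹ := by linear_combination -(f p)⁻¹ * hGF p hp
    rw [h, hf_def]
    field_simp
  rw [hinv, inv_inv]
  refine ⟨inv_ne_zero hGp, hf0 p hp, ?_, hYG p hp⟩
  rw [show f p * (G p)⁻¹ ^ 2 = F p by rw [hf_def]; field_simp]
  exact (hXF p hp).1
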